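/- Let $G\ge 2$. For each group $i=1,\dots,G$ let $X_{i,1},X_{i,2},\dots$ be i.i.d. real random variables with mean $\mu_i$ and finite variance $\sigma_i^2$. For a sample size $r$ put $\bar Y_i=\frac1r\sum_{j=1}^r X_{i,j}$ and let $\widehat{\sigma_i^2}=\frac1{r-1}\sum_{j=1}^r (X_{i,j}-\bar Y_i)^2$ be the unbiased sample variance. Assume that for every $r$ the sample means $\bar Y_1,\dots,\bar Y_G$ are independent. Write $\mu=(\mu_1,\dots,\mu_G)$, $\bar Y=(\bar Y_1,\dots,\bar Y_G)$, and, for $y\in\mathbb R^G$, $\operatorname{avg}(y)=\frac1G\sum_i y_i$ and $m_k(y)=\frac1G\sum_i (y_i-\operatorname{avg}(y))^k$. Let $$H(y)=\frac1{G-1}\sum_{i=1}^G (y_i-\operatorname{avg}(y))^2 .$$ Let $0<\alpha<1$ and let $z_{1-\alpha}$ be the $(1-\frac{\alpha}{2})$-quantile of the standard normal distribution. (Variance of averages.) Suppose that some group $s$ has $\sigma_s^2>0$ and $\mu_s\ne\operatorname{avg}(\mu)$. Put $$\widehat{\tau^2}=\sum_{s=1}^G \widehat{\sigma_s^2}\left(\frac{2}{G-1}\bigl(\bar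 Y_s-\operatorname{avg}(\bar Y)\bigr)\right)^2,\qquad \varepsilon_r=\sqrt{\frac{z_{1-\alpha}^2\,\widehat{\tau^2}}{r}} .$$ Then $$\lim_{r\to\infty}P\bigl(H(\mu)\in[H(\bar Y)-\varepsilon_r,\;H(\bar Y)+\varepsilon_r]\bigr)=1-\alpha ,$$ and almost surely $\varepsilon_r>0$ for all sufficiently large $r$. (Skewness and kurtosis of averages.) The same conclusions hold with $H$ replaced by $h$, where $h$ is either the skewness $h(y)=m_3(y)\,H(y)^{\beta}$ for any fixed real exponent $\beta$ (the usual one is $\beta=-\frac32$) or the kurtosis $h(y)=m_4(y)\left(\frac{G-1}{G}H(y)\right)^{-2}-3$, with $\widehat{\tau^2}=\sum_s\widehat{\sigma_s^2}\,\bigl(\frac{\partial h}{\partial y_s}(\bar Y)\bigr)^2$, provided that $H(\mu)\neq0$ and that some $s$ has $\sigma_s^2>0$ and $\frac{\partial h}{\partial y_s}(\mu)\ne0$. (Sums.) Let $c_1,\dots,c_G>0$ be the group sizes. All of the above holds with $\bar Y$ replaced by $S=(c_1\bar Y_1,\dots,c_G\bar Y_G)$, $\mu$ replaced by $(c_1\mu_1,\dots,c_G\mu_G)$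 (also in the non-degeneracy conditions), and $\widehat{\sigma_s^2}$ replaced by $c_s^2\,\widehat{\sigma_s^2}$ in $\widehat{\tau^2}$. -/

import Mathlib

open MeasureTheory ProbabilityTheory Filter Topology

noncomputable section

namespace EarlyStop

variable {G : ℕ} {Ω : Type*}

/-! ### Interestingness functions of a vector of `G` aggregated values -/

/-- The average `(1/G) ∑ⱼ yⱼ` of the entries of `y`. -/
def avg (y : Fin G → ℝ) : ℝ := (1 / (G : ℝ)) * ∑ j, y j

/-- The `k`-th central moment `(1/G) ∑ᵢ (yᵢ - avg y)ᵏ` of the entries of `y`. -/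
def centralMoment (k : ℕ) (y : Fin G → ℝ) : ℝ :=
  (1 / (G : ℝ)) * ∑ i, (y i - avg y) ^ k

/-- Variance: `(1/(G-1)) ∑ᵢ (yᵢ - avg y)²`. -/
def varianceScore (y : Fin G → ℝ) : ℝ :=
  (1 / ((G : ℝ) - 1)) * ∑ i, (y i - avg y) ^ 2

/-- Skewness: the third central moment normalised by the power `β` of the variance.
The usual normalisation is `β = -3/2`. -/
def skewnessScore (β : ℝ) (y : Fin G → ℝ) : ℝ :=
  centralMoment 3 y * varianceScore y ^ β

/-- (Excess) kurtosis. -/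
def kurtosisScore (y : Fin G → ℝ) : ℝ :=
  centralMoment 4 y * ((((G : ℝ) - 1) / (G : ℝ) * varianceScore y) ^ 2)⁻¹ - 3

/-- The gradient of `varianceScore`, in closed form: `∂/∂yₛ = (2/(G-1)) (yₛ - avg y)`. -/
def varianceGrad (y : Fin G → ℝ) (s : Fin G) : ℝ :=
  (2 / ((G : ℝ) - 1)) * (y s - avg y)

/-- The vector of partial derivatives of `h` at `y`. -/
def grad (h : (Fin G → ℝ) → ℝ) (y : Fin G → ℝ) (s : Fin G) : ℝ :=
  fderiv ℝ h y (Pi.single s 1)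

/-! ### Estimators built from a sample of size `r` in each group

`X i j` is the value of the `j`-th sampled fact of group `i`, for `j = 0, 1, 2, …`. -/

/-- The sample mean `(1/r) ∑_{j<r} Xⱼ` of one group. -/
def sampleMean (X : ℕ → Ω → ℝ) (r : ℕ) (ω : Ω) : ℝ :=
  (1 / (r : ℝ)) * ∑ j ∈ Finset.range r, X j ω

/-- The unbiased sample variance `(1/(r-1)) ∑_{j<r} (Xⱼ - mean)²` of one group. -/
def sampleVar (X : ℕ → Ω → ℝ) (r : ℕ) (ω : Ω) : ℝ :=
  (1 / ((r : ℝ) - 1)) * ∑ j ∈ Finset.range r, (X j ω - sampleMean X r ω) ^ 2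

/-- The vector of the sample means of all groups: the estimates for the aggregate function
average. -/
def avgEstimate (X : Fin G → ℕ → Ω → ℝ) (r : ℕ) (ω : Ω) : Fin G → ℝ :=
  fun i => sampleMean (X i) r ω

/-- The vector of the sample means multiplied by the group sizes `c i`: the estimates for the
aggregate function sum. -/
def sumEstimate (c : Fin G → ℝ) (X : Fin G → ℕ → Ω → ℝ) (r : ℕ) (ω : Ω) : Fin G → ℝ :=
  fun i => c i * sampleMean (X i) r ω

/-- The plug-in estimator `∑ₛ σ̂²ₛ (Dₛ(Ȳ))²` of the asymptotic variance, for averages;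
`D` is the gradient of the interestingness function. -/
def tauSqHatAvg (D : (Fin G → ℝ) → Fin G → ℝ) (X : Fin G → ℕ → Ω → ℝ) (r : ℕ) (ω : Ω) : ℝ :=
  ∑ s, sampleVar (X s) r ω * D (avgEstimate X r ω) s ^ 2

/-- The plug-in estimator `∑ₛ cₛ² σ̂²ₛ (Dₛ(S))²` of the asymptotic variance, for sums. -/
def tauSqHatSum (c : Fin G → ℝ) (D : (Fin G → ℝ) → Fin G → ℝ) (X : Fin G → ℕ → Ω → ℝ)
    (r : ℕ) (ω : Ω) : ℝ :=
  ∑ s, c s ^ 2 * sampleVar (X s) r ω * D (sumEstimate c X r ω) s ^ 2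

/-! ### Confidence intervals -/

/-- `z_p`, the `(p+1)/2` quantile of the standard normal distribution. -/
def zQuantile (p : ℝ) : ℝ :=
  sInf {x : ℝ | (p + 1) / 2 ≤ cdf (gaussianReal 0 1) x}

/-- The half-width `ε_r = √(z_{1-α}² τ̂² / r)`. -/
def halfWidth (α : ℝ) (tauSqHat : ℕ → Ω → ℝ) (r : ℕ) (ω : Ω) : ℝ :=
  √(zQuantile (1 - α) ^ 2 * tauSqHat r ω / (r : ℝ))

/-- The random intervals `[θ̂_r - ε_r, θ̂_r + ε_r]` are large-sample confidence intervals for `θ`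
at level `1 - α`: the coverage probability tends to `1 - α` as the sample size `r` grows, and
almost surely the half-widths are positive for all large `r`. -/
def IsLargeSampleCI [MeasurableSpace Ω] (P : Measure Ω) (α θ : ℝ) (est ε : ℕ → Ω → ℝ) : Prop :=
  Tendsto (fun r => P.real {ω | θ ∈ Set.Icc (est r ω - ε r ω) (est r ω + ε r ω)})
      atTop (𝓝 (1 - α)) ∧
    ∀ᵐ ω ∂P, ∀ᶠ r in atTop, 0 < ε r ω

end EarlyStop

end

/-!
The argument is the delta method with a studentized half-width.

Write `Ȳᵣ` for the vector of sample means. In each group the central limit theorem applies, and the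
independence of the sample means makes the law of `√r (Ȳᵣ - μ)` the product of the laws of its
entries. Products of probability measures depend continuously on their factors, so `√r (Ȳᵣ - μ)`
converges in distribution to a vector `Z` of independent normal variables
(`IsGroupSampling.tendstoInDistribution_avgEstimate`). By the strong law of large numbers `Ȳᵣ`
tends to `μ`, and the plug-in estimator `τ̂²ᵣ` to `τ² = ∑ₛ σ²ₛ (∂ₛh(μ))²`, almost surely
(`IsGroupSampling.tendsto_tauSqHatAvg`).

With `L` the derivative of the score `h` at `μ` and `ρ(y)` the remainder of the first-order expansion
divided by `‖y - μ‖`, `√r (h(Ȳᵣ) - h(μ)) = L Wᵣ + ‖Wᵣ‖ ρ(Ȳᵣ)` where `Wᵣ = √r (Ȳᵣ - μ)`. As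
`(ρ(Ȳᵣ), τ̂²ᵣ) → (0, τ²)`, Slutsky's theorem and the continuous mapping theorem give the limit in
distribution of `|√r (h(Ȳᵣ) - h(μ))| - √(z² τ̂²ᵣ)`, and the coverage event is that this variable is
at most `0` (`tendsto_measureReal_deltaMethod`). In the limit `L Z` is normal with variance
`τ² > 0`, has no atoms, and lies within `z τ` of `0` with probability `1 - α`
(`gaussianReal_real_abs_le`). The half-width is eventually positive because `τ̂²ᵣ → τ² > 0`.

The three scores are continuously differentiable wherever the variance score is nonzero (the variance
itself everywhere). Sums are the averages of the rescaled variables `c i * X i j`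
(`IsGroupSampling.const_mul`, `sumEstimate_eq`, `tauSqHatSum_eq`).
-/

namespace EarlyStop

variable {G : ℕ} {Ω : Type*}

/-! ### Quantiles and linear combinations of normal variables -/

theorem continuous_cdf (ν : Measure ℝ) [IsProbabilityMeasure ν] [NullSingletonClass ν] :
    Continuous (cdf ν) := by
  refine continuous_iff_continuousAt.2 fun a => ?_
  rw [(monotone_cdf ν).continuousAt_iff_leftLim_eq_rightLim, StieltjesFunction.rightLim_eq]
  have h : (cdf ν).measure {a} = 0 := by rw [measure_cdf]; exact measure_singleton a
  rw [StieltjesFunction.measure_singleton, ENNReal.ofReal_eq_zero] at h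
  exact le_antisymm ((monotone_cdf ν).leftLim_le le_rfl) (by linarith)

theorem cdf_zQuantile {p : ℝ} (h0 : 0 < p) (h1 : p < 1) :
    cdf (gaussianReal 0 1) (zQuantile p) = (p + 1) / 2 := by
  have : NullSingletonClass (gaussianReal 0 1) := nullSingletonClass_gaussianReal one_ne_zero
  set F := cdf (gaussianReal 0 1)
  have hF : Continuous F := continuous_cdf _
  obtain ⟨a, ha⟩ := ((tendsto_cdf_atBot (gaussianReal 0 1)).eventually
    (gt_mem_nhds (show (0 : ℝ) < (p + 1) / 2 by linarith))).exists
  obtain ⟨b, hb⟩ := ((tendsto_cdf_atTop (gaussianReal 0 1)).eventually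
    (lt_mem_nhds (show (p + 1) / 2 < (1 : ℝ) by linarith))).exists
  obtain ⟨x, hx⟩ := mem_range_of_exists_le_of_exists_ge hF ⟨a, ha.le⟩ ⟨b, hb.le⟩
  have hbdd : BddBelow {x : ℝ | (p + 1) / 2 ≤ F x} := by
    refine ⟨a, fun y hy => ?_⟩
    by_contra! hlt
    exact absurd (hy.trans (monotone_cdf _ hlt.le)) (not_le.2 ha)
  refine le_antisymm ?_ ?_
  · rw [← hx]
    exact monotone_cdf _ (csInf_le hbdd hx.ge)
  · exact (isClosed_le continuous_const hF).csInf_mem ⟨x, hx.ge⟩ hbdd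

/-- The symmetry of the normal distribution: the lower tail at `-z` is the upper tail at `z`. -/
theorem gaussianReal_real_Iio_neg (z : ℝ) :
    (gaussianReal 0 1).real (Set.Iio (-z)) = 1 - (gaussianReal 0 1).real (Set.Iic z) := by
  rw [← probReal_compl_eq_one_sub measurableSet_Iic, Set.compl_Iic]
  conv_rhs => rw [← neg_zero (G := ℝ), ← gaussianReal_map_neg]
  rw [map_measureReal_apply measurable_neg measurableSet_Ioi]
  congr 1
  ext x
  simp

theorem zQuantile_pos {p : ℝ} (h0 : 0 < p) (h1 : p < 1) : 0 < zQuantile p := by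
  have hz := cdf_zQuantile h0 h1
  rw [cdf_eq_real] at hz
  by_contra! hneg
  have : NullSingletonClass (gaussianReal 0 1) := nullSingletonClass_gaussianReal one_ne_zero
  -- if `z ≤ 0`, then `P(x < z) ≤ P(x < -z) = 1 - P(x ≤ z)`, which forces `(p + 1) / 2 ≤ 1 / 2`
  have hle : (gaussianReal 0 1).real (Set.Iio (zQuantile p))
      ≤ (gaussianReal 0 1).real (Set.Iio (-zQuantile p)) :=
    measureReal_mono (Set.Iio_subset_Iio (by linarith))
  rw [measureReal_congr Iio_ae_eq_Iic, gaussianReal_real_Iio_neg] at hle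
  linarith

/-- A centred normal variable of variance `v > 0` lies within `z_p √v` of `0` with
probability `p`. -/
theorem gaussianReal_real_abs_le {p : ℝ} (h0 : 0 < p) (h1 : p < 1) {v : ℝ} (hv : 0 < v) :
    (gaussianReal 0 v.toNNReal).real {x | |x| ≤ √(zQuantile p ^ 2 * v)} = p := by
  have hz := zQuantile_pos h0 h1
  have hF := cdf_zQuantile h0 h1
  rw [cdf_eq_real] at hF
  have hlaw : gaussianReal 0 v.toNNReal = (gaussianReal 0 1).map (√v * ·) := by
    rw [gaussianReal_map_const_mul]
    congr 1
    · simp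
    · ext
      simp [Real.sq_sqrt hv.le, hv.le]
  have hpre : (√v * ·) ⁻¹' {x | |x| ≤ √(zQuantile p ^ 2 * v)}
      = Set.Iic (zQuantile p) \ Set.Iio (-zQuantile p) := by
    ext x
    have hs : 0 < √v := Real.sqrt_pos.2 hv
    rw [Real.sqrt_mul (sq_nonneg _), Real.sqrt_sq hz.le]
    simp only [Set.mem_preimage, Set.mem_ofPred_eq, abs_mul, abs_of_pos hs, Set.mem_sdiff,
      Set.mem_Iic, Set.mem_Iio, not_lt]
    rw [mul_comm, mul_le_mul_iff_left₀ hs, abs_le, and_comm]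
  rw [hlaw, map_measureReal_apply (by fun_prop) (measurableSet_le (by fun_prop) (by fun_prop)),
    hpre, measureReal_sdiff _ measurableSet_Iio, gaussianReal_real_Iio_neg, hF]
  · ring
  · intro x (hx : x < _)
    show x ≤ _
    linarith

/-- A linear combination of independent centred normal variables is a centred normal variable. -/
theorem map_pi_gaussianReal_sum {ι : Type*} [Fintype ι] (a v : ι → ℝ) (hv : ∀ i, 0 ≤ v i) :
    (Measure.pi fun i => gaussianReal 0 (v i).toNNReal).map (fun x => ∑ i, x i * a i)
      = gaussianReal 0 (∑ i, v i * a i ^ 2).toNNReal := by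
  have hm : ∀ i, Measurable fun x : ι → ℝ => x i * a i := fun i => by fun_prop
  have hX : iIndepFun (fun i (x : ι → ℝ) => x i * a i)
      (Measure.pi fun i => gaussianReal 0 (v i).toNNReal) :=
    iIndepFun_pi (X := fun i x => x * a i) fun i => by fun_prop
  have : IsProbabilityMeasure ((Measure.pi fun i => gaussianReal 0 (v i).toNNReal).map
      (fun x => ∑ i, x i * a i)) :=
    Measure.isProbabilityMeasure_map (Finset.measurable_fun_sum _ fun i _ => hm i).aemeasurable
  refine Measure.ext_of_charFun (funext fun t => ?_)
  rw [hX.charFun_map_fun_sum_eq_prod (fun i => (hm i).aemeasurable), Finset.prod_apply]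
  have hi : ∀ i, charFun ((Measure.pi fun i => gaussianReal 0 (v i).toNNReal).map
      (fun x => x i * a i)) t = Complex.exp (-(v i * a i ^ 2 * t ^ 2 / 2 : ℂ)) := fun i => by
    have hlaw : (Measure.pi fun i => gaussianReal 0 (v i).toNNReal).map (fun x => x i * a i)
        = (gaussianReal 0 (v i).toNNReal).map (· * a i) := by
      rw [← (measurePreserving_eval (fun i => gaussianReal 0 (v i).toNNReal) i).map_eq,
        Measure.map_map (by fun_prop) (by fun_prop)]
      rfl
    rw [hlaw, gaussianReal_map_mul_const, charFun_gaussianReal]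
    congr 1
    simp [hv i]
    left
    ring
  simp_rw [hi]
  rw [← Complex.exp_sum, charFun_gaussianReal]
  congr 1
  simp only [Real.coe_toNNReal _ (Finset.sum_nonneg fun i _ =>
    mul_nonneg (hv i) (sq_nonneg (a i)))]
  push_cast
  rw [Finset.sum_neg_distrib, Finset.sum_mul, Finset.sum_div]
  simp

/-! ### Consistency of the sample mean and the sample variance -/

theorem tendsto_sampleMean [MeasurableSpace Ω] {P : Measure Ω} {X : ℕ → Ω → ℝ}
    (hint : Integrable (X 0) P) (hindep : iIndepFun X P)
    (hident : ∀ j, IdentDistrib (X j) (X 0) P P) :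
    ∀ᵐ ω ∂P, Tendsto (fun r => sampleMean X r ω) atTop (𝓝 (∫ ω, X 0 ω ∂P)) := by
  filter_upwards [strong_law_ae_real X hint (fun i j hij => hindep.indepFun hij) hident] with ω hω
  refine hω.congr fun r => ?_
  rw [sampleMean, div_eq_inv_mul, one_div]

/-- The algebraic identity behind the consistency of the sample variance: it is `r / (r - 1)` times
the mean of the squares minus the square of the mean. -/
theorem sampleVar_eq (X : ℕ → Ω → ℝ) {r : ℕ} (hr : r ≠ 0) (ω : Ω) :
    sampleVar X r ω = (r : ℝ) / ((r : ℝ) - 1) *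
      (sampleMean (fun j ω => X j ω ^ 2) r ω - sampleMean X r ω ^ 2) := by
  have hr' : (r : ℝ) ≠ 0 := by exact_mod_cast hr
  have hsum : ∑ j ∈ Finset.range r, X j ω = r * sampleMean X r ω := by
    rw [sampleMean]; field_simp
  have hsq : ∑ j ∈ Finset.range r, X j ω ^ 2 = r * sampleMean (fun j ω => X j ω ^ 2) r ω := by
    rw [sampleMean]; field_simp
  rw [sampleVar]
  simp only [sub_sq, Finset.sum_add_distrib, Finset.sum_sub_distrib, ← Finset.mul_sum,
    ← Finset.sum_mul, hsum, hsq, Finset.sum_const, Finset.card_range, nsmul_eq_mul]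
  ring

theorem tendsto_sampleVar [MeasurableSpace Ω] {P : Measure Ω} [IsProbabilityMeasure P]
    {X : ℕ → Ω → ℝ} (hL2 : MemLp (X 0) 2 P) (hindep : iIndepFun X P)
    (hident : ∀ j, IdentDistrib (X j) (X 0) P P) :
    ∀ᵐ ω ∂P, Tendsto (fun r => sampleVar X r ω) atTop (𝓝 (variance (X 0) P)) := by
  have hsq := tendsto_sampleMean (X := fun j ω => X j ω ^ 2) hL2.integrable_sq
    (hindep.comp (fun _ x => x ^ 2) fun _ => by fun_prop)
    (fun j => (hident j).comp (u := fun x => x ^ 2) (by fun_prop))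
  filter_upwards [tendsto_sampleMean (hL2.integrable one_le_two) hindep hident, hsq] with ω h1 h2
  have hratio : Tendsto (fun r : ℕ => (r : ℝ) / ((r : ℝ) - 1)) atTop (𝓝 1) := by
    simpa [sub_eq_add_neg] using tendsto_natCast_div_add_atTop (-1 : ℝ)
  rw [variance_eq_sub hL2]
  have := hratio.mul (h2.sub (h1.pow 2))
  rw [one_mul] at this
  refine this.congr' ?_
  filter_upwards [eventually_ne_atTop 0] with r hr using (sampleVar_eq X hr ω).symm

theorem sampleMean_const_mul (c : ℝ) (X : ℕ → Ω → ℝ) (r : ℕ) (ω : Ω) :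
    sampleMean (fun j ω => c * X j ω) r ω = c * sampleMean X r ω := by
  rw [sampleMean, sampleMean, ← Finset.mul_sum]; ring

theorem sampleVar_const_mul (c : ℝ) (X : ℕ → Ω → ℝ) (r : ℕ) (ω : Ω) :
    sampleVar (fun j ω => c * X j ω) r ω = c ^ 2 * sampleVar X r ω := by
  simp only [sampleVar, sampleMean_const_mul, ← mul_sub, mul_pow, ← Finset.mul_sum]; ring

/-! ### The joint law of the sample means -/

/-- The sampling scheme: in each group an i.i.d. sequence of square integrable variables with mean
`μ i` and variance `σsq i`, such that for each sample size the sample means of the groups are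
independent of each other. -/
structure IsGroupSampling [MeasurableSpace Ω] (P : Measure Ω) (X : Fin G → ℕ → Ω → ℝ)
    (μ σsq : Fin G → ℝ) : Prop where
  memLp : ∀ i j, MemLp (X i j) 2 P
  indep : ∀ i, iIndepFun (X i) P
  ident : ∀ i j, IdentDistrib (X i j) (X i 0) P P
  mean : ∀ i, ∫ ω, X i 0 ω ∂P = μ i
  var : ∀ i, variance (X i 0) P = σsq i
  groups : ∀ r, iIndepFun (fun i => sampleMean (X i) r) P

namespace IsGroupSampling
variable [MeasurableSpace Ω] {P : Measure Ω} {X : Fin G → ℕ → Ω → ℝ} {μ σsq : Fin G → ℝ}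

theorem const_mul (h : IsGroupSampling P X μ σsq) (c : Fin G → ℝ) :
    IsGroupSampling P (fun i j ω => c i * X i j ω) (fun i => c i * μ i)
      (fun i => c i ^ 2 * σsq i) where
  memLp i j := (h.memLp i j).const_mul (c i)
  indep i := (h.indep i).comp (fun _ x => c i * x) fun _ => by fun_prop
  ident i j := (h.ident i j).comp (u := fun x => c i * x) (by fun_prop)
  mean i := by rw [integral_const_mul, h.mean]
  var i := by rw [variance_const_mul, h.var]
  groups r := by
    have := (h.groups r).comp (fun i x => c i * x) fun _ => by fun_prop
    convert! this using 2 with i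
    funext ω
    exact sampleMean_const_mul _ _ _ _

theorem var_nonneg (h : IsGroupSampling P X μ σsq) (i : Fin G) : 0 ≤ σsq i :=
  h.var i ▸ variance_nonneg _ _

theorem aemeasurable (h : IsGroupSampling P X μ σsq) (i : Fin G) (j : ℕ) :
    AEMeasurable (X i j) P := (h.ident i j).aemeasurable_fst

theorem aemeasurable_sampleMean (h : IsGroupSampling P X μ σsq) (i : Fin G) (r : ℕ) :
    AEMeasurable (sampleMean (X i) r) P :=
  (Finset.aemeasurable_fun_sum _ fun j _ => h.aemeasurable i j).const_mul _

theorem aemeasurable_sampleVar (h : IsGroupSampling P X μ σsq) (i : Fin G) (r : ℕ) :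
    AEMeasurable (sampleVar (X i) r) P :=
  (Finset.aemeasurable_fun_sum _ fun j _ =>
    ((h.aemeasurable i j).sub (h.aemeasurable_sampleMean i r)).pow_const 2).const_mul _

theorem aemeasurable_avgEstimate (h : IsGroupSampling P X μ σsq) (r : ℕ) :
    AEMeasurable (avgEstimate X r) P :=
  aemeasurable_pi_lambda _ fun i => h.aemeasurable_sampleMean i r

theorem aemeasurable_tauSqHatAvg (h : IsGroupSampling P X μ σsq) {D : (Fin G → ℝ) → Fin G → ℝ}
    (hD : Measurable D) (r : ℕ) : AEMeasurable (tauSqHatAvg D X r) P :=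
  Finset.aemeasurable_fun_sum _ fun s _ => (h.aemeasurable_sampleVar s r).mul
    ((((measurable_pi_apply s).comp hD).comp_aemeasurable (h.aemeasurable_avgEstimate r)).pow_const 2)

variable [IsProbabilityMeasure P]

theorem tendsto_avgEstimate (h : IsGroupSampling P X μ σsq) :
    ∀ᵐ ω ∂P, Tendsto (fun r => avgEstimate X r ω) atTop (𝓝 μ) := by
  have : ∀ᵐ ω ∂P, ∀ i, Tendsto (fun r => sampleMean (X i) r ω) atTop (𝓝 (μ i)) :=
    ae_all_iff.2 fun i => h.mean i ▸
      tendsto_sampleMean ((h.memLp i 0).integrable one_le_two) (h.indep i) (h.ident i)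
  filter_upwards [this] with ω hω using tendsto_pi_nhds.2 hω

theorem tendsto_tauSqHatAvg (h : IsGroupSampling P X μ σsq) {D : (Fin G → ℝ) → Fin G → ℝ}
    (hD : ContinuousAt D μ) :
    ∀ᵐ ω ∂P, Tendsto (fun r => tauSqHatAvg D X r ω) atTop (𝓝 (∑ s, σsq s * D μ s ^ 2)) := by
  have hv : ∀ᵐ ω ∂P, ∀ i, Tendsto (fun r => sampleVar (X i) r ω) atTop (𝓝 (σsq i)) :=
    ae_all_iff.2 fun i => h.var i ▸ tendsto_sampleVar (h.memLp i 0) (h.indep i) (h.ident i)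
  filter_upwards [hv, h.tendsto_avgEstimate] with ω hω hY
  exact tendsto_finsetSum _ fun s _ =>
    (hω s).mul ((tendsto_pi_nhds.1 (hD.tendsto.comp hY) s).pow 2)

/-- The **multivariate central limit theorem** for the vector of sample means. Since the sample means
are independent for each sample size, the law of the vector is the product of the laws of its
entries, and the product measure depends continuously on its factors. -/
theorem tendstoInDistribution_avgEstimate (h : IsGroupSampling P X μ σsq) :
    TendstoInDistribution (fun (r : ℕ) ω => √(r : ℝ) • (avgEstimate X r ω - μ)) atTop
      (id : (Fin G → ℝ) → Fin G → ℝ) (fun _ => P)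
      (Measure.pi fun i => gaussianReal 0 (σsq i).toNNReal) := by
  have hlim : ∀ i, TendstoInDistribution
      (fun (r : ℕ) ω => √(r : ℝ) * (sampleMean (X i) r ω - μ i)) atTop
      (id : ℝ → ℝ) (fun _ => P) (gaussianReal 0 (σsq i).toNNReal) := fun i => by
    have hclt := tendstoInDistribution_inv_sqrt_mul_sum_sub
      (Y := (id : ℝ → ℝ)) (P' := gaussianReal 0 (σsq i).toNNReal) (X := X i) (P := P)
      ⟨by fun_prop, by rw [h.var, Measure.map_id]⟩ (h.memLp i 0) (h.indep i) (h.ident i)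
    rw [h.mean] at hclt
    convert! hclt using 3 with r ω
    rcases Nat.eq_zero_or_pos r with rfl | hr
    · simp
    · have hr' : (0 : ℝ) < r := by exact_mod_cast hr
      rw [sampleMean]
      have hs := Real.sq_sqrt hr'.le
      have hs0 : √(r : ℝ) ≠ 0 := (Real.sqrt_pos.2 hr').ne'
      field_simp
      rw [hs]
  have hmeas := fun i r => (hlim i).forall_aemeasurable r
  refine ⟨fun r => aemeasurable_pi_lambda _ fun i => hmeas i r, aemeasurable_id, ?_⟩
  have key := ((ProbabilityMeasure.continuous_pi (α := fun _ : Fin G => ℝ)).tendsto _).comp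
    (tendsto_pi_nhds.2 fun i => (hlim i).tendsto)
  have hlimit : (⟨(Measure.pi fun i => gaussianReal 0 (σsq i).toNNReal).map id,
      Measure.isProbabilityMeasure_map aemeasurable_id⟩ : ProbabilityMeasure (Fin G → ℝ))
      = ProbabilityMeasure.pi fun i => ⟨(gaussianReal 0 (σsq i).toNNReal).map id,
        Measure.isProbabilityMeasure_map aemeasurable_id⟩ := by
    refine Subtype.ext ?_
    simp only [Measure.map_id]
    rfl
  rw [hlimit]
  refine key.congr fun r => ?_
  refine Subtype.ext ?_
  have hind : iIndepFun (fun i ω => √(r : ℝ) * (sampleMean (X i) r ω - μ i)) P :=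
    (h.groups r).comp (fun i x => √(r : ℝ) * (x - μ i)) fun _ => by fun_prop
  exact ((iIndepFun_iff_map_fun_eq_pi_map fun i => hmeas i r).1 hind).symm

end IsGroupSampling

/-! ### The delta method and confidence intervals -/

/-- The **delta method** with a random half-width. If `√r (Yᵣ - θ)` converges in distribution to `Z`,
`Yᵣ → θ` and `Vᵣ → v` almost surely, and `h` is differentiable at `θ` with derivative `L`, then the
probability of `√r |h(Yᵣ) - h(θ)| ≤ √(b Vᵣ)` tends to that of `|L Z| ≤ √(b v)`. -/
theorem tendsto_measureReal_deltaMethod {E Ω' : Type*} [NormedAddCommGroup E] [NormedSpace ℝ E]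
    [MeasurableSpace E] [BorelSpace E] [SecondCountableTopology E]
    [MeasurableSpace Ω] {P : Measure Ω} [IsProbabilityMeasure P]
    [MeasurableSpace Ω'] {P' : Measure Ω'} [IsProbabilityMeasure P']
    {Y : ℕ → Ω → E} {V : ℕ → Ω → ℝ} {Z : Ω' → E} {θ : E} {v b : ℝ} {h : E → ℝ} {L : E →L[ℝ] ℝ}
    (hYm : ∀ r, AEMeasurable (Y r) P) (hVm : ∀ r, AEMeasurable (V r) P) (hhm : Measurable h)
    (hclt : TendstoInDistribution (fun (r : ℕ) ω => √(r : ℝ) • (Y r ω - θ)) atTop Z (fun _ => P) P')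
    (hY : ∀ᵐ ω ∂P, Tendsto (fun r => Y r ω) atTop (𝓝 θ))
    (hV : ∀ᵐ ω ∂P, Tendsto (fun r => V r ω) atTop (𝓝 v))
    (hh : HasFDerivAt h L θ) (hatom : P' {ω | |L (Z ω)| = √(b * v)} = 0) :
    Tendsto (fun r : ℕ => P.real {ω | √(r : ℝ) * |h (Y r ω) - h θ| ≤ √(b * V r ω)}) atTop
      (𝓝 (P'.real {ω | |L (Z ω)| ≤ √(b * v)})) := by
  -- the normalised remainder of the first-order expansion of `h`; it is `0` at `θ`
  set ρ : E → ℝ := fun y => ‖y - θ‖⁻¹ * (h y - h θ - L (y - θ)) with hρdef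
  have hρ : Tendsto ρ (𝓝 θ) (𝓝 0) := by
    have := hasFDerivAt_iff_tendsto.1 hh
    refine tendsto_zero_iff_norm_tendsto_zero.2 (this.congr fun y => ?_)
    simp [hρdef]
  have hρm : Measurable ρ := by fun_prop
  have hexp : ∀ y, h y - h θ = L (y - θ) + ‖y - θ‖ * ρ y := fun y => by
    rcases eq_or_ne y θ with rfl | hy
    · simp
    · have : ‖y - θ‖ ≠ 0 := norm_ne_zero_iff.2 (sub_ne_zero.2 hy)
      simp only [hρdef]
      field_simp
      ring
  have hWm : ∀ r, AEMeasurable (fun ω => (ρ (Y r ω), V r ω)) P := fun r =>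
    (hρm.comp_aemeasurable (hYm r)).prodMk (hVm r)
  have hW : TendstoInMeasure P (fun r ω => (ρ (Y r ω), V r ω)) atTop (fun _ => ((0 : ℝ), v)) := by
    refine tendstoInMeasure_of_tendsto_ae (fun r => (hWm r).aestronglyMeasurable) ?_
    filter_upwards [hY, hV] with ω h1 h2 using (hρ.comp h1).prodMk_nhds h2
  have hconv := hclt.continuous_comp_prodMk_of_tendstoInMeasure_const
    (g := fun q : E × (ℝ × ℝ) => |L q.1 + ‖q.1‖ * q.2.1| - √(b * q.2.2)) (by fun_prop) hW hWm
  have hport := ProbabilityMeasure.tendsto_measure_of_null_frontier_of_tendsto'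
    hconv.tendsto (E := Set.Iic 0) (by
      rw [frontier_Iic, ProbabilityMeasure.coe_mk,
        Measure.map_apply_of_aemeasurable hconv.aemeasurable_limit (measurableSet_singleton 0)]
      refine measure_mono_null (fun ω hω => ?_) hatom
      simpa [sub_eq_zero] using hω)
  simp only [ProbabilityMeasure.coe_mk] at hport
  rw [Measure.map_apply_of_aemeasurable hconv.aemeasurable_limit measurableSet_Iic] at hport
  have hreal := (ENNReal.tendsto_toReal (measure_ne_top P' _)).comp hport
  convert! hreal using 2
  · rename_i r
    rw [Function.comp_apply, Measure.map_apply_of_aemeasurable (hconv.forall_aemeasurable r)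
      measurableSet_Iic, Measure.real]
    congr 2
    ext ω
    have h0 := Real.sqrt_nonneg (r : ℝ)
    have : L (√(r : ℝ) • (Y r ω - θ)) + ‖√(r : ℝ) • (Y r ω - θ)‖ * ρ (Y r ω)
        = √(r : ℝ) * (h (Y r ω) - h θ) := by
      rw [hexp, map_smul, norm_smul, Real.norm_of_nonneg h0, smul_eq_mul]
      ring
    simp only [Set.mem_ofPred_eq, Set.mem_preimage, Set.mem_Iic, this, abs_mul, abs_of_nonneg h0,
      sub_nonpos]
  · rw [Measure.real]
    congr 2
    ext ω
    simp

/-- Large-sample confidence intervals for a score `h` whose gradient at `μ` is `D μ`; only the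
continuity of `D` at `μ` is needed to plug in the estimate of `μ`. -/
theorem IsGroupSampling.isLargeSampleCI [MeasurableSpace Ω] {P : Measure Ω} [IsProbabilityMeasure P]
    {X : Fin G → ℕ → Ω → ℝ} {μ σsq : Fin G → ℝ} (hX : IsGroupSampling P X μ σsq)
    {α : ℝ} (hα0 : 0 < α) (hα1 : α < 1) {h : (Fin G → ℝ) → ℝ} {D : (Fin G → ℝ) → Fin G → ℝ}
    (hh : DifferentiableAt ℝ h μ) (hgrad : grad h μ = D μ) (hD : ContinuousAt D μ)
    (hhm : Measurable h) (hDm : Measurable D) (hnd : ∃ s, σsq s ≠ 0 ∧ D μ s ≠ 0) :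
    IsLargeSampleCI P α (h μ) (fun r ω => h (avgEstimate X r ω))
      (halfWidth α (tauSqHatAvg D X)) := by
  have hp0 : 0 < 1 - α := by linarith
  have hp1 : 1 - α < 1 := by linarith
  have hτ : 0 < ∑ s, σsq s * D μ s ^ 2 := by
    obtain ⟨s, hs, hDs⟩ := hnd
    exact Finset.sum_pos' (fun i _ => mul_nonneg (hX.var_nonneg i) (sq_nonneg _))
      ⟨s, Finset.mem_univ s, mul_pos ((hX.var_nonneg s).lt_of_ne' hs) (by positivity)⟩
  have hlim := hX.tendsto_tauSqHatAvg hD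
  have hz := zQuantile_pos hp0 hp1
  refine ⟨?_, ?_⟩
  · have hL : ∀ x, fderiv ℝ h μ x = ∑ i, x i * D μ i := fun x => by
      conv_lhs => rw [pi_eq_sum_univ' x, map_sum]
      refine Finset.sum_congr rfl fun i _ => ?_
      rw [map_smul, smul_eq_mul, ← hgrad]
      rfl
    set P' := Measure.pi fun i => gaussianReal 0 (σsq i).toNNReal
    set v := ∑ s, σsq s * D μ s ^ 2 with hv
    -- under the limit law the linear part is normal with variance `v`
    have hpre : ∀ S : Set ℝ, MeasurableSet S →
        P' {x | fderiv ℝ h μ x ∈ S} = gaussianReal 0 v.toNNReal S := fun S hS => by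
      rw [hv, ← map_pi_gaussianReal_sum _ _ hX.var_nonneg, Measure.map_apply (by fun_prop) hS]
      simp only [hL]
      rfl
    have hatoms : NullSingletonClass (gaussianReal 0 v.toNNReal) :=
      nullSingletonClass_gaussianReal (Real.toNNReal_pos.2 hτ).ne'
    have hmain := tendsto_measureReal_deltaMethod (b := zQuantile (1 - α) ^ 2)
      hX.aemeasurable_avgEstimate (hX.aemeasurable_tauSqHatAvg hDm) hhm
      hX.tendstoInDistribution_avgEstimate hX.tendsto_avgEstimate hlim hh.hasFDerivAt (by
        refine (hpre {t | |t| = √(zQuantile (1 - α) ^ 2 * v)}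
          (measurableSet_eq_fun (by fun_prop) (by fun_prop))).trans ?_
        refine measure_mono_null (t := {√(zQuantile (1 - α) ^ 2 * v),
          -√(zQuantile (1 - α) ^ 2 * v)}) (fun t ht => ?_) (Set.Countable.measure_zero ?_ _)
        · exact eq_or_eq_neg_of_abs_eq ht
        · exact (Set.toFinite _).countable)
    have hval : P'.real {x | |fderiv ℝ h μ (id x)| ≤ √(zQuantile (1 - α) ^ 2 * v)} = 1 - α := by
      refine Eq.trans ?_ (gaussianReal_real_abs_le hp0 hp1 hτ)
      rw [Measure.real, Measure.real]
      congr 1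
      exact hpre {t | |t| ≤ √(zQuantile (1 - α) ^ 2 * v)}
        (measurableSet_le (by fun_prop) (by fun_prop))
    rw [hval] at hmain
    refine hmain.congr' ?_
    -- at `r = 0` the half-width is a division by zero, so the two events are compared for `r > 0`
    filter_upwards [eventually_gt_atTop 0] with r hr
    have hr' : 0 < √(r : ℝ) := Real.sqrt_pos.2 (by exact_mod_cast hr)
    congr 1
    ext ω
    simp only [Set.mem_ofPred_eq, Set.mem_Icc, halfWidth]
    rw [Real.sqrt_div' _ (Nat.cast_nonneg r), mul_comm, ← le_div_iff₀ hr', abs_le]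
    constructor <;> rintro ⟨h1, h2⟩ <;> constructor <;> linarith
  · filter_upwards [hlim] with ω hω
    filter_upwards [hω.eventually (lt_mem_nhds hτ), eventually_gt_atTop 0] with r h1 h2
    have : (0 : ℝ) < r := by exact_mod_cast h2
    exact Real.sqrt_pos.2 (by positivity)

/-! ### Smoothness and gradients of the scores -/

theorem contDiff_avg {n : WithTop ℕ∞} : ContDiff ℝ n (avg : (Fin G → ℝ) → ℝ) := by
  unfold avg; fun_prop

theorem contDiff_centralMoment (k : ℕ) {n : WithTop ℕ∞} :
    ContDiff ℝ n (centralMoment k : (Fin G → ℝ) → ℝ) := by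
  have := contDiff_avg (G := G) (n := n)
  unfold centralMoment; fun_prop

theorem contDiff_varianceScore {n : WithTop ℕ∞} :
    ContDiff ℝ n (varianceScore : (Fin G → ℝ) → ℝ) := by
  have := contDiff_avg (G := G) (n := n)
  unfold varianceScore; fun_prop

theorem sum_sub_avg (hG : G ≠ 0) (y : Fin G → ℝ) : ∑ i, (y i - avg y) = 0 := by
  have : (G : ℝ) ≠ 0 := by exact_mod_cast hG
  rw [Finset.sum_sub_distrib, Finset.sum_const, Finset.card_univ, Fintype.card_fin, nsmul_eq_mul,
    avg]
  field_simp
  ring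

/-- The derivative of the average drops out of the gradient of the variance because the deviations
from the average sum to `0`. -/
theorem grad_varianceScore (hG : G ≠ 0) (y : Fin G → ℝ) :
    grad varianceScore y = varianceGrad y := by
  funext s
  -- the derivative along the line through `y` in the direction of the unit vector of `s`
  have hline : HasDerivAt (fun t : ℝ => varianceScore (y + t • Pi.single s (1 : ℝ)))
      (fderiv ℝ varianceScore y (Pi.single s 1)) 0 := by
    have h1 : HasFDerivAt varianceScore (fderiv ℝ varianceScore y)
        (y + (0 : ℝ) • Pi.single s (1 : ℝ)) := by
      simpa using ((contDiff_varianceScore (n := 1)).differentiable one_ne_zero y).hasFDerivAt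
    have h2 : HasDerivAt (fun t : ℝ => y + t • (Pi.single s (1 : ℝ) : Fin G → ℝ))
        (Pi.single s 1) 0 := by
      simpa using ((hasDerivAt_id (0 : ℝ)).smul_const
        (Pi.single s (1 : ℝ) : Fin G → ℝ)).const_add y
    exact h1.comp_hasDerivAt 0 h2
  have havg : ∀ t : ℝ, avg (y + t • Pi.single s (1 : ℝ)) = avg y + t * (1 / G) := fun t => by
    simp only [avg, Pi.add_apply, Pi.smul_apply, smul_eq_mul, Finset.sum_add_distrib,
      ← Finset.mul_sum, Finset.sum_pi_single', Finset.mem_univ, if_true]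
    ring
  have hdir : HasDerivAt (fun t : ℝ => varianceScore (y + t • Pi.single s (1 : ℝ)))
      (1 / ((G : ℝ) - 1) * ∑ i, 2 * (y i - avg y) * ((Pi.single s (1 : ℝ) : Fin G → ℝ) i - 1 / G))
      0 := by
    simp only [varianceScore, havg]
    refine (HasDerivAt.fun_sum fun i _ => ?_).const_mul _
    have hi : HasDerivAt (fun t : ℝ => (y + t • (Pi.single s (1 : ℝ) : Fin G → ℝ)) i
        - (avg y + t * (1 / G))) ((Pi.single s (1 : ℝ) : Fin G → ℝ) i - 1 / G) 0 := by
      simpa using (((hasDerivAt_id (0 : ℝ)).mul_const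
        ((Pi.single s (1 : ℝ) : Fin G → ℝ) i)).const_add (y i)).fun_sub
        (((hasDerivAt_id (0 : ℝ)).mul_const (1 / (G : ℝ))).const_add (avg y))
    simpa using hi.fun_pow 2
  rw [grad, hline.unique hdir, varianceGrad]
  have hsum : ∑ i, 2 * (y i - avg y) * ((Pi.single s (1 : ℝ) : Fin G → ℝ) i - 1 / G)
      = 2 * (y s - avg y) := by
    simp only [mul_sub _ _ (1 / (G : ℝ)), Finset.sum_sub_distrib, ← Finset.sum_mul,
      ← Finset.mul_sum, sum_sub_avg hG]
    simp [Pi.single_apply]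
  rw [hsum]
  ring

theorem sq_mul_varianceScore_ne_zero (hG : 2 ≤ G) {y : Fin G → ℝ} (hy : varianceScore y ≠ 0) :
    (((G : ℝ) - 1) / G * varianceScore y) ^ 2 ≠ 0 := by
  have : (2 : ℝ) ≤ G := by exact_mod_cast hG
  have h1 : (G : ℝ) - 1 ≠ 0 := by linarith
  have h2 : (G : ℝ) ≠ 0 := by linarith
  positivity

theorem contDiffAt_skewnessScore (β : ℝ) {n : WithTop ℕ∞} {y : Fin G → ℝ}
    (hy : varianceScore y ≠ 0) : ContDiffAt ℝ n (skewnessScore β) y :=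
  (contDiff_centralMoment 3).contDiffAt.mul
    (contDiff_varianceScore.contDiffAt.rpow_const_of_ne hy)

theorem contDiffAt_kurtosisScore (hG : 2 ≤ G) {n : WithTop ℕ∞} {y : Fin G → ℝ}
    (hy : varianceScore y ≠ 0) : ContDiffAt ℝ n kurtosisScore y :=
  ((contDiff_centralMoment 4).contDiffAt.mul
    (((contDiff_const.mul contDiff_varianceScore).pow 2).contDiffAt.inv
      (sq_mul_varianceScore_ne_zero hG hy))).sub contDiffAt_const

theorem measurable_skewnessScore (β : ℝ) : Measurable (skewnessScore β : (Fin G → ℝ) → ℝ) :=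
  (contDiff_centralMoment 3 (n := 0)).continuous.measurable.mul
    ((contDiff_varianceScore (n := 0)).continuous.measurable.pow_const β)

theorem measurable_kurtosisScore : Measurable (kurtosisScore : (Fin G → ℝ) → ℝ) :=
  ((contDiff_centralMoment 4 (n := 0)).continuous.measurable.mul
    ((((contDiff_varianceScore (n := 0)).continuous.measurable.const_mul _).pow_const 2).inv)).sub
      measurable_const

theorem measurable_grad (h : (Fin G → ℝ) → ℝ) : Measurable (grad h) :=
  measurable_pi_lambda _ fun s => measurable_fderiv_apply_const ℝ h (Pi.single s 1)

theorem continuousAt_grad {h : (Fin G → ℝ) → ℝ} {y : Fin G → ℝ} (hh : ContDiffAt ℝ 1 h y) :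
    ContinuousAt (grad h) y :=
  continuousAt_pi.2 fun _ =>
    (hh.continuousAt_fderiv one_ne_zero).clm_apply continuousAt_const

/-- Estimating sums is estimating averages of the rescaled variables `c i * X i j`. -/
theorem sumEstimate_eq (c : Fin G → ℝ) (X : Fin G → ℕ → Ω → ℝ) :
    sumEstimate c X = avgEstimate fun i j ω => c i * X i j ω := by
  funext r ω i
  exact (sampleMean_const_mul _ _ _ _).symm

theorem tauSqHatSum_eq (c : Fin G → ℝ) (D : (Fin G → ℝ) → Fin G → ℝ) (X : Fin G → ℕ → Ω → ℝ) :
    tauSqHatSum c D X = tauSqHatAvg D fun i j ω => c i * X i j ω := by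
  funext r ω
  simp only [tauSqHatSum, tauSqHatAvg, sumEstimate_eq, sampleVar_const_mul]

variable [MeasurableSpace Ω] {P : Measure Ω} [IsProbabilityMeasure P]
  {X : Fin G → ℕ → Ω → ℝ} {μ σsq : Fin G → ℝ} {α : ℝ}

theorem IsGroupSampling.isLargeSampleCI_grad (hX : IsGroupSampling P X μ σsq)
    (hα0 : 0 < α) (hα1 : α < 1) {h : (Fin G → ℝ) → ℝ} (hh : ContDiffAt ℝ 1 h μ)
    (hhm : Measurable h) (hnd : ∃ s, σsq s ≠ 0 ∧ grad h μ s ≠ 0) :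
    IsLargeSampleCI P α (h μ) (fun r ω => h (avgEstimate X r ω))
      (halfWidth α (tauSqHatAvg (grad h) X)) :=
  hX.isLargeSampleCI hα0 hα1 (hh.differentiableAt one_ne_zero) rfl (continuousAt_grad hh) hhm
    (measurable_grad h) hnd

theorem IsGroupSampling.isLargeSampleCI_varianceScore (hX : IsGroupSampling P X μ σsq)
    (hG : 2 ≤ G) (hα0 : 0 < α) (hα1 : α < 1) (hnd : ∃ s, σsq s ≠ 0 ∧ μ s ≠ avg μ) :
    IsLargeSampleCI P α (varianceScore μ) (fun r ω => varianceScore (avgEstimate X r ω))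
      (halfWidth α (tauSqHatAvg varianceGrad X)) := by
  have hgrad : (grad varianceScore : (Fin G → ℝ) → Fin G → ℝ) = varianceGrad :=
    funext fun y => grad_varianceScore (by omega) y
  rw [← hgrad]
  refine hX.isLargeSampleCI_grad hα0 hα1 contDiff_varianceScore.contDiffAt
    (contDiff_varianceScore (n := 0)).continuous.measurable ?_
  obtain ⟨s, h1, h2⟩ := hnd
  refine ⟨s, h1, ?_⟩
  have : (2 : ℝ) ≤ G := by exact_mod_cast hG
  rw [hgrad]
  exact mul_ne_zero (div_ne_zero two_ne_zero (by linarith)) (sub_ne_zero.2 h2)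

end EarlyStop

theorem theorem3 {Ω : Type*} [MeasurableSpace Ω] (P : Measure Ω) [IsProbabilityMeasure P]
    (G : ℕ) (hG : 2 ≤ G)
    -- the sampled values: within each group i.i.d. with mean `μ i` and finite variance `σsq i`
    (X : Fin G → ℕ → Ω → ℝ) (μ σsq : Fin G → ℝ)
    (hL2 : ∀ i j, MemLp (X i j) 2 P)
    (hindep : ∀ i, iIndepFun (X i) P)
    (hident : ∀ i j, IdentDistrib (X i j) (X i 0) P P)
    (hmean : ∀ i, ∫ ω, X i 0 ω ∂P = μ i)
    (hvar : ∀ i, variance (X i 0) P = σsq i)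
    -- the sample means of the different groups are independent
    (hgroups : ∀ r, iIndepFun (fun i => EarlyStop.sampleMean (X i) r) P)
    (α : ℝ) (hα0 : 0 < α) (hα1 : α < 1) :
    -- averages, variance
    ((∃ s, σsq s ≠ 0 ∧ μ s ≠ EarlyStop.avg μ) →
      EarlyStop.IsLargeSampleCI P α (EarlyStop.varianceScore μ)
        (fun r ω => EarlyStop.varianceScore (EarlyStop.avgEstimate X r ω))
        (EarlyStop.halfWidth α (EarlyStop.tauSqHatAvg EarlyStop.varianceGrad X))) ∧
    -- averages, skewness
    (∀ β : ℝ, EarlyStop.varianceScore μ ≠ 0 →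
      (∃ s, σsq s ≠ 0 ∧ EarlyStop.grad (EarlyStop.skewnessScore β) μ s ≠ 0) →
      EarlyStop.IsLargeSampleCI P α (EarlyStop.skewnessScore β μ)
        (fun r ω => EarlyStop.skewnessScore β (EarlyStop.avgEstimate X r ω))
        (EarlyStop.halfWidth α
          (EarlyStop.tauSqHatAvg (EarlyStop.grad (EarlyStop.skewnessScore β)) X))) ∧
    -- averages, kurtosis
    (EarlyStop.varianceScore μ ≠ 0 →
      (∃ s, σsq s ≠ 0 ∧ EarlyStop.grad EarlyStop.kurtosisScore μ s ≠ 0) →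
      EarlyStop.IsLargeSampleCI P α (EarlyStop.kurtosisScore μ)
        (fun r ω => EarlyStop.kurtosisScore (EarlyStop.avgEstimate X r ω))
        (EarlyStop.halfWidth α
          (EarlyStop.tauSqHatAvg (EarlyStop.grad EarlyStop.kurtosisScore) X))) ∧
    -- the same three for sums, with group sizes `c i`
    (∀ c : Fin G → ℝ, (∀ i, 0 < c i) →
      ((∃ s, σsq s ≠ 0 ∧ c s * μ s ≠ EarlyStop.avg (fun i => c i * μ i)) →
        EarlyStop.IsLargeSampleCI P α (EarlyStop.varianceScore (fun i => c i * μ i))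
          (fun r ω => EarlyStop.varianceScore (EarlyStop.sumEstimate c X r ω))
          (EarlyStop.halfWidth α (EarlyStop.tauSqHatSum c EarlyStop.varianceGrad X))) ∧
      (∀ β : ℝ, EarlyStop.varianceScore (fun i => c i * μ i) ≠ 0 →
        (∃ s, σsq s ≠ 0 ∧
          EarlyStop.grad (EarlyStop.skewnessScore β) (fun i => c i * μ i) s ≠ 0) →
        EarlyStop.IsLargeSampleCI P α (EarlyStop.skewnessScore β (fun i => c i * μ i))
          (fun r ω => EarlyStop.skewnessScore β (EarlyStop.sumEstimate c X r ω))
          (EarlyStop.halfWidth α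
            (EarlyStop.tauSqHatSum c (EarlyStop.grad (EarlyStop.skewnessScore β)) X))) ∧
      (EarlyStop.varianceScore (fun i => c i * μ i) ≠ 0 →
        (∃ s, σsq s ≠ 0 ∧
          EarlyStop.grad EarlyStop.kurtosisScore (fun i => c i * μ i) s ≠ 0) →
        EarlyStop.IsLargeSampleCI P α (EarlyStop.kurtosisScore (fun i => c i * μ i))
          (fun r ω => EarlyStop.kurtosisScore (EarlyStop.sumEstimate c X r ω))
          (EarlyStop.halfWidth α
            (EarlyStop.tauSqHatSum c (EarlyStop.grad EarlyStop.kurtosisScore) X)))) := by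
  have hX : EarlyStop.IsGroupSampling P X μ σsq := ⟨hL2, hindep, hident, hmean, hvar, hgroups⟩
  refine ⟨hX.isLargeSampleCI_varianceScore hG hα0 hα1,
    fun β hH hnd => hX.isLargeSampleCI_grad hα0 hα1
      (EarlyStop.contDiffAt_skewnessScore β hH) (EarlyStop.measurable_skewnessScore β) hnd,
    fun hH hnd => hX.isLargeSampleCI_grad hα0 hα1
      (EarlyStop.contDiffAt_kurtosisScore hG hH) EarlyStop.measurable_kurtosisScore hnd,
    fun c hc => ?_⟩
  have hcX := hX.const_mul c
  have hpos : ∀ {q : Fin G → Prop}, (∃ s, σsq s ≠ 0 ∧ q s) → ∃ s, c s ^ 2 * σsq s ≠ 0 ∧ q s :=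
    fun ⟨s, hs, hq⟩ => ⟨s, mul_ne_zero (pow_ne_zero 2 (hc s).ne') hs, hq⟩
  simp only [EarlyStop.sumEstimate_eq, EarlyStop.tauSqHatSum_eq]
  exact ⟨fun hnd => hcX.isLargeSampleCI_varianceScore hG hα0 hα1 (hpos hnd),
    fun β hH hnd => hcX.isLargeSampleCI_grad hα0 hα1
      (EarlyStop.contDiffAt_skewnessScore β hH) (EarlyStop.measurable_skewnessScore β) (hpos hnd),
    fun hH hnd => hcX.isLargeSampleCI_grad hα0 hα1
      (EarlyStop.contDiffAt_kurtosisScore hG hH) EarlyStop.measurable_kurtosisScore (hpos hnd)⟩
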